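/- Let $n\ge 1$ and let $M_1,\dots,M_d$ be non-empty, pairwise disjoint subsets of $[n]=\{1,\dots,n\}$ with union $[n]$; put $m_k=|M_k|$. Let $Z=(z_{j,r})$ be a complex $n\times n$ matrix with permanent $\operatorname{per} Z=\sum_{\sigma}\prod_{r=1}^n z_{\sigma(r),r}$, where $\sigma$ runs over all permutations of $[n]$, and put $\alpha_{j,k}=\frac{1}{m_k}\sum_{r\in M_k}|z_{j,r}|^2$ for $1\le j\le n$, $1\le k\le d$. Then $$|\operatorname{per} Z|\le n!\prod_{k=1}^d\Bigl(\frac{1}{\binom{n}{m_k}}\sum_{I\subseteq[n],\,|I|=m_k}\ \prod_{j\in I}\alpha_{j,k}\Bigr)^{1/2}.$$ Moreover, if $m_k=1$ for all $k$, then the right-hand side equals $n!\prod_{r=1}^n\bigl(\frac1n\sum_{j=1}^n|z_{j,r}|^2\bigr)^{1/2}$, so that the inequality becomes the Carlen–Lieb–Loss Hadamard-type bound for permanents. -/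

import Mathlib

/-- The row averages `α_j = (1/|S|) ∑_{r ∈ S} |z_{j,r}|²` over a block `S` of columns. -/
noncomputable def blockMean {n : ℕ} (Z : Matrix (Fin n) (Fin n) ℂ) (S : Finset (Fin n))
    (j : Fin n) : ℝ :=
  (1 / (S.card : ℝ)) * ∑ r ∈ S, ‖Z j r‖ ^ 2

/-- The bound `n! ∏_k ( C(n,m_k)⁻¹ ∑_{|I| = m_k} ∏_{j ∈ I} α_{j,k} )^{1/2}`, `m_k = |M_k|`. -/
noncomputable def blockBound {n d : ℕ} (Z : Matrix (Fin n) (Fin n) ℂ)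
    (M : Fin d → Finset (Fin n)) : ℝ :=
  (n.factorial : ℝ) * ∏ k : Fin d,
    Real.sqrt ((1 / (n.choose (M k).card : ℝ)) *
      ∑ I ∈ (Finset.univ : Finset (Fin n)).powersetCard (M k).card,
        ∏ j ∈ I, blockMean Z (M k) j)

open MvPolynomial

/-! The permanent is the coefficient of x_1⋯x_n in the product of the column forms ℓ_r = ∑_j z_{j,r}
x_j. Measure the squarefree coefficients c_J of degree m by the mean of |c_J / m!|² over the
m-subsets J; this is `sliceNormSq`, normalised so that (x_1 + ⋯ + x_n)^m has norm 1 for m ≤ n.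

This norm is submultiplicative (`sliceNormSq_subsetConv_le`): induction on the ground set, splitting
off one variable, reduces the claim to the scalar inequality `slice_quadratic_le`. Applied to the n
forms ℓ_r, it gives the Carlen–Lieb–Loss bound.

Applied instead to the block products ∏_{r ∈ M_k} ℓ_r, it leaves their norms to be estimated. Their
squarefree coefficients of degree m_k are permanents of m_k × m_k submatrices, and the
Carlen–Lieb–Loss bound, used along rows, produces the products of the α_{j,k}. -/

/-! ### Convolution over subsets -/

theorem Finset.sum_powersetCard_succ_insert {α M : Type*} [DecidableEq α] [AddCommMonoid M]
    {a : α} {S : Finset α} (ha : a ∉ S) (k : ℕ) (F : Finset α → M) :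
    ∑ K ∈ (insert a S).powersetCard (k + 1), F K =
      ∑ K ∈ S.powersetCard (k + 1), F K + ∑ K ∈ S.powersetCard k, F (insert a K) := by
  rw [Finset.powersetCard_succ_insert ha, Finset.sum_union, Finset.sum_image]
  · intro J hJ K hK h
    have hJa : a ∉ J := fun h' => ha ((Finset.mem_powersetCard.1 hJ).1 h')
    have hKa : a ∉ K := fun h' => ha ((Finset.mem_powersetCard.1 hK).1 h')
    rw [← Finset.erase_insert hJa, ← Finset.erase_insert hKa, h]
  · rw [Finset.disjoint_left]
    intro J hJ hJ'
    obtain ⟨K, -, rfl⟩ := Finset.mem_image.1 hJ'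
    exact ha ((Finset.mem_powersetCard.1 hJ).1 (Finset.mem_insert_self a K))

/-- The convolution `K ↦ ∑ g J * h (K \ J)` over the subsets `J` of `K` of cardinality `m`. -/
def subsetConv {α : Type*} [DecidableEq α] (m : ℕ) (g h : Finset α → ℝ) (K : Finset α) : ℝ :=
  ∑ J ∈ K.powersetCard m, g J * h (K \ J)

/-- A Leibniz rule: `a` goes either to the second factor or to the first. -/
theorem subsetConv_insert {α : Type*} [DecidableEq α] {a : α} {K : Finset α} (ha : a ∉ K) (m : ℕ)
    (g h : Finset α → ℝ) :
    subsetConv (m + 1) g h (insert a K) =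
      subsetConv (m + 1) g (fun J => h (insert a J)) K +
        subsetConv m (fun J => g (insert a J)) h K := by
  unfold subsetConv
  rw [Finset.sum_powersetCard_succ_insert ha]
  congr 1
  · refine Finset.sum_congr rfl fun J hJ => ?_
    rw [Finset.insert_sdiff_of_notMem _ fun h' => ha ((Finset.mem_powersetCard.1 hJ).1 h')]
  · refine Finset.sum_congr rfl fun J hJ => ?_
    rw [Finset.insert_sdiff_insert, Finset.sdiff_insert_of_notMem ha]

/-! ### The weighted norm and its submultiplicativity -/

/-- The weight `(n - m)! / (n! m!)` of the subsets of cardinality `m` of a set of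
cardinality `n`. -/
noncomputable def sliceWeight (n m : ℕ) : ℝ :=
  ((n - m).factorial : ℝ) / (n.factorial * m.factorial)

theorem sliceWeight_nonneg (n m : ℕ) : 0 ≤ sliceWeight n m := by
  unfold sliceWeight; positivity

theorem sliceWeight_zero (n : ℕ) : sliceWeight n 0 = 1 := by
  have := Nat.factorial_ne_zero n
  simp [sliceWeight, this]

theorem sliceWeight_succ_left {n m : ℕ} (h : m ≤ n) :
    sliceWeight (n + 1) m = ((n + 1 : ℝ) - m) / (n + 1) * sliceWeight n m := by
  have h1 := Nat.factorial_ne_zero n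
  have h2 := Nat.factorial_ne_zero m
  have h3 : ((n - m : ℕ) : ℝ) = n - m := Nat.cast_sub h
  unfold sliceWeight
  rw [Nat.succ_sub h, Nat.factorial_succ, Nat.factorial_succ]
  push_cast
  rw [h3]
  field_simp
  ring

theorem sliceWeight_succ_succ (n m : ℕ) :
    sliceWeight (n + 1) (m + 1) = sliceWeight n m / ((n + 1) * (m + 1)) := by
  have h1 := Nat.factorial_ne_zero n
  have h2 := Nat.factorial_ne_zero m
  unfold sliceWeight
  rw [Nat.add_sub_add_right, Nat.factorial_succ, Nat.factorial_succ]
  push_cast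
  field_simp

/-- The weighted square sum of `g` over the subsets of `S` of cardinality `m`. -/
noncomputable def sliceNormSq {α : Type*} (S : Finset α) (m : ℕ) (g : Finset α → ℝ) : ℝ :=
  sliceWeight S.card m * ∑ J ∈ S.powersetCard m, g J ^ 2

theorem sliceNormSq_nonneg {α : Type*} (S : Finset α) (m : ℕ) (g : Finset α → ℝ) :
    0 ≤ sliceNormSq S m g :=
  mul_nonneg (sliceWeight_nonneg _ _) (Finset.sum_nonneg fun _ _ => sq_nonneg _)

theorem sliceNormSq_zero {α : Type*} (S : Finset α) (g : Finset α → ℝ) :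
    sliceNormSq S 0 g = g ∅ ^ 2 := by
  simp [sliceNormSq, sliceWeight_zero]

theorem sliceNormSq_of_card_lt {α : Type*} {S : Finset α} {m : ℕ} (h : S.card < m)
    (g : Finset α → ℝ) : sliceNormSq S m g = 0 := by
  simp [sliceNormSq, Finset.powersetCard_eq_empty.2 h]

theorem sliceNormSq_congr {α : Type*} {S : Finset α} {m : ℕ} {g h : Finset α → ℝ}
    (H : ∀ J ∈ S.powersetCard m, g J = h J) : sliceNormSq S m g = sliceNormSq S m h := by
  unfold sliceNormSq
  rw [Finset.sum_congr rfl fun J hJ => by rw [H J hJ]]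

theorem sliceNormSq_mono {α : Type*} {S : Finset α} {m : ℕ} {g h : Finset α → ℝ}
    (H : ∀ J ∈ S.powersetCard m, g J ^ 2 ≤ h J ^ 2) : sliceNormSq S m g ≤ sliceNormSq S m h :=
  mul_le_mul_of_nonneg_left (Finset.sum_le_sum H) (sliceWeight_nonneg _ _)

/-- Minkowski's inequality, with the cross term bounded by Cauchy–Schwarz. -/
theorem sliceNormSq_add_le {α : Type*} {S : Finset α} {m : ℕ} {g h : Finset α → ℝ} {a b : ℝ}
    (ha : 0 ≤ a) (hb : 0 ≤ b) (hg : sliceNormSq S m g ≤ a ^ 2) (hh : sliceNormSq S m h ≤ b ^ 2) :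
    sliceNormSq S m (fun J => g J + h J) ≤ (a + b) ^ 2 := by
  have hw := sliceWeight_nonneg S.card m
  have hcs := Finset.sum_mul_sq_le_sq_mul_sq (S.powersetCard m) g h
  have hg0 := sliceNormSq_nonneg S m g
  have hh0 := sliceNormSq_nonneg S m h
  unfold sliceNormSq at *
  set w := sliceWeight S.card m
  have hcross : w * ∑ J ∈ S.powersetCard m, g J * h J ≤ a * b := by
    refine (abs_le_of_sq_le_sq' ?_ (mul_nonneg ha hb)).2
    calc (w * ∑ J ∈ S.powersetCard m, g J * h J) ^ 2
        = w ^ 2 * (∑ J ∈ S.powersetCard m, g J * h J) ^ 2 := by ring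
      _ ≤ w ^ 2 * ((∑ J ∈ S.powersetCard m, g J ^ 2) * ∑ J ∈ S.powersetCard m, h J ^ 2) := by
        gcongr
      _ = (w * ∑ J ∈ S.powersetCard m, g J ^ 2) * (w * ∑ J ∈ S.powersetCard m, h J ^ 2) := by
        ring
      _ ≤ a ^ 2 * b ^ 2 := mul_le_mul hg hh hh0 (sq_nonneg a)
      _ = (a * b) ^ 2 := by ring
  have hexp : ∑ J ∈ S.powersetCard m, (g J + h J) ^ 2 =
      ∑ J ∈ S.powersetCard m, g J ^ 2 + 2 * ∑ J ∈ S.powersetCard m, g J * h J +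
        ∑ J ∈ S.powersetCard m, h J ^ 2 := by
    rw [Finset.mul_sum, ← Finset.sum_add_distrib, ← Finset.sum_add_distrib]
    exact Finset.sum_congr rfl fun J _ => by ring
  rw [hexp]
  nlinarith

theorem sliceNormSq_insert {α : Type*} [DecidableEq α] {a : α} {S : Finset α} (ha : a ∉ S) {m : ℕ}
    (hm : m ≤ S.card) (g : Finset α → ℝ) :
    sliceNormSq (insert a S) (m + 1) g =
      ((S.card : ℝ) - m) / (S.card + 1) * sliceNormSq S (m + 1) g +
        sliceNormSq S m (fun J => g (insert a J)) / ((S.card + 1) * (m + 1)) := by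
  have h1 : sliceWeight (S.card + 1) (m + 1) * ∑ J ∈ S.powersetCard (m + 1), g J ^ 2 =
      ((S.card : ℝ) - m) / (S.card + 1) * sliceNormSq S (m + 1) g := by
    -- If m = |S|, there are no (m+1)-subsets and the coefficient vanishes too; the weight recursion
    -- needs m + 1 ≤ |S|.
    rcases hm.eq_or_lt with h | h
    · rw [sliceNormSq_of_card_lt (by omega), Finset.powersetCard_eq_empty.2 (by omega)]
      simp
    · rw [sliceWeight_succ_left h, sliceNormSq]
      push_cast
      ring
  rw [sliceNormSq, Finset.card_insert_of_notMem ha, Finset.sum_powersetCard_succ_insert ha,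
    mul_add, h1, sliceWeight_succ_succ, sliceNormSq, sliceNormSq]
  ring

/-- The difference of the two sides is a combination of two squares; `M + L ≤ N` makes the second
coefficient nonnegative. In use, N is the size of the enlarged ground set, M and L are the degrees,
and p, q (resp. r, s) are the norms of the parts of a factor without and with the new variable. -/
theorem slice_quadratic_le {N M L p q r s : ℝ} (hN : 0 < N) (hM : 0 < M) (hL : 0 < L)
    (hML : M + L ≤ N) :
    (N - (M + L)) / N * (p ^ 2 * r ^ 2) + (p * s + q * r) ^ 2 / (N * (M + L)) ≤
      ((N - M) / N * p ^ 2 + q ^ 2 / (N * M)) * ((N - L) / N * r ^ 2 + s ^ 2 / (N * L)) := by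
  have hid : ((N - M) / N * p ^ 2 + q ^ 2 / (N * M)) * ((N - L) / N * r ^ 2 + s ^ 2 / (N * L)) -
      ((N - (M + L)) / N * (p ^ 2 * r ^ 2) + (p * s + q * r) ^ 2 / (N * (M + L))) =
      M * L / N ^ 2 * ((p * r - q / M * (s / L)) ^ 2 +
        (N - (M + L)) / (M + L) * (q / M * r - p * (s / L)) ^ 2) := by
    have : M + L ≠ 0 := by positivity
    field_simp
    ring
  have h0 : 0 ≤ N - (M + L) := by linarith
  have : 0 ≤ M * L / N ^ 2 * ((p * r - q / M * (s / L)) ^ 2 +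
        (N - (M + L)) / (M + L) * (q / M * r - p * (s / L)) ^ 2) := by positivity
  linarith

/-- The weighted square sums are submultiplicative under convolution. -/
theorem sliceNormSq_subsetConv_le {α : Type*} [DecidableEq α] (S : Finset α) (m l : ℕ)
    (g h : Finset α → ℝ) :
    sliceNormSq S (m + l) (subsetConv m g h) ≤ sliceNormSq S m g * sliceNormSq S l h := by
  induction S using Finset.induction_on generalizing m l g h with
  | empty =>
    rcases m with _ | m
    · rcases l with _ | l
      · simp [sliceNormSq_zero, subsetConv, mul_pow]
      · rw [sliceNormSq_of_card_lt (by simp), sliceNormSq_of_card_lt (m := l + 1) (by simp)]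
        simp
    · rw [sliceNormSq_of_card_lt (by simp), sliceNormSq_of_card_lt (m := m + 1) (by simp)]
      simp
  | insert a S ha ih =>
    -- A factor of degree zero is a scalar and gives equality; it is set apart because the quadratic
    -- inequality divides by both degrees.
    rcases m with _ | m
    · rw [sliceNormSq_zero, zero_add]
      apply le_of_eq
      simp only [sliceNormSq, subsetConv, Finset.powersetCard_zero, Finset.sum_singleton,
        Finset.sdiff_empty, mul_pow, ← Finset.mul_sum]
      ring
    rcases l with _ | l
    · rw [sliceNormSq_zero, add_zero]
      apply le_of_eq
      have : ∀ J ∈ (insert a S).powersetCard (m + 1), subsetConv (m + 1) g h J = g J * h ∅ := by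
        intro J hJ
        rw [← (Finset.mem_powersetCard.1 hJ).2]
        simp [subsetConv]
      rw [sliceNormSq_congr this]
      simp [sliceNormSq, mul_pow, ← Finset.sum_mul]
      ring
    by_cases hc : S.card < m + 1 + l
    · rw [sliceNormSq_of_card_lt (by rw [Finset.card_insert_of_notMem ha]; omega)]
      exact mul_nonneg (sliceNormSq_nonneg _ _ _) (sliceNormSq_nonneg _ _ _)
    push Not at hc
    have h00 := ih (m + 1) (l + 1) g h
    have h01 := ih (m + 1) l g (fun J => h (insert a J))
    have h10 := ih m (l + 1) (fun J => g (insert a J)) h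
    rw [show m + 1 + (l + 1) = m + 1 + l + 1 by ring] at h00 ⊢
    rw [show m + (l + 1) = m + 1 + l by ring] at h10
    rw [sliceNormSq_insert ha hc, sliceNormSq_insert ha (by omega : m ≤ S.card),
      sliceNormSq_insert ha (by omega : l ≤ S.card)]
    have hins : sliceNormSq S (m + 1 + l) (fun K => subsetConv (m + 1) g h (insert a K)) =
        sliceNormSq S (m + 1 + l) (fun K => subsetConv (m + 1) g (fun J => h (insert a J)) K +
          subsetConv m (fun J => g (insert a J)) h K) :=
      sliceNormSq_congr fun K hK =>
        subsetConv_insert (fun h' => ha ((Finset.mem_powersetCard.1 hK).1 h')) m g h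
    rw [hins]
    -- Minkowski's inequality needs the norms themselves, hence the square roots.
    obtain ⟨p, hp, hp2⟩ : ∃ p : ℝ, 0 ≤ p ∧ sliceNormSq S (m + 1) g = p ^ 2 :=
      ⟨_, Real.sqrt_nonneg _, (Real.sq_sqrt (sliceNormSq_nonneg _ _ _)).symm⟩
    obtain ⟨q, hq, hq2⟩ : ∃ q : ℝ, 0 ≤ q ∧ sliceNormSq S m (fun J => g (insert a J)) = q ^ 2 :=
      ⟨_, Real.sqrt_nonneg _, (Real.sq_sqrt (sliceNormSq_nonneg _ _ _)).symm⟩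
    obtain ⟨r, hr, hr2⟩ : ∃ r : ℝ, 0 ≤ r ∧ sliceNormSq S (l + 1) h = r ^ 2 :=
      ⟨_, Real.sqrt_nonneg _, (Real.sq_sqrt (sliceNormSq_nonneg _ _ _)).symm⟩
    obtain ⟨s, hs, hs2⟩ : ∃ s : ℝ, 0 ≤ s ∧ sliceNormSq S l (fun J => h (insert a J)) = s ^ 2 :=
      ⟨_, Real.sqrt_nonneg _, (Real.sq_sqrt (sliceNormSq_nonneg _ _ _)).symm⟩
    rw [hp2, hr2] at h00
    rw [hp2, hs2, ← mul_pow] at h01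
    rw [hq2, hr2, ← mul_pow] at h10
    have hadd := sliceNormSq_add_le (mul_nonneg hp hs) (mul_nonneg hq hr) h01 h10
    rw [hp2, hq2, hr2, hs2]
    have hcR : (m : ℝ) + 1 + l ≤ S.card := by exact_mod_cast hc
    have key := slice_quadratic_le (N := S.card + 1) (M := m + 1) (L := l + 1) (p := p) (q := q)
      (r := r) (s := s) (by positivity) (by positivity) (by positivity) (by linarith)
    have e1 : (S.card : ℝ) + 1 - (m + 1) = S.card - m := by ring
    have e2 : (S.card : ℝ) + 1 - (l + 1) = S.card - l := by ring
    have e3 : (S.card : ℝ) + 1 - (m + 1 + (l + 1)) = S.card - (m + 1 + l) := by ring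
    rw [e1, e2, e3] at key
    refine le_trans ?_ key
    push_cast
    have hcoef : 0 ≤ ((S.card : ℝ) - (m + 1 + l)) / (S.card + 1) :=
      div_nonneg (by linarith) (by positivity)
    refine add_le_add (mul_le_mul_of_nonneg_left h00 hcoef) ?_
    rw [show (m : ℝ) + 1 + l + 1 = m + 1 + (l + 1) by ring]
    gcongr

/-! ### Squarefree coefficients of products -/

/-- The exponent vector of the squarefree monomial `∏ j ∈ J, X j`. -/
noncomputable def squarefreeExponent {α : Type*} (J : Finset α) : α →₀ ℕ :=
  Finsupp.indicator J fun _ _ => 1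

theorem squarefreeExponent_apply {α : Type*} [DecidableEq α] (J : Finset α) (j : α) :
    squarefreeExponent J j = if j ∈ J then 1 else 0 := by
  simp [squarefreeExponent, Finsupp.indicator_apply]

theorem squarefreeExponent_injective {α : Type*} :
    Function.Injective (squarefreeExponent : Finset α → α →₀ ℕ) := by
  classical
  intro J K h
  ext j
  have := DFunLike.congr_fun h j
  rw [squarefreeExponent_apply, squarefreeExponent_apply] at this
  by_cases hJ : j ∈ J <;> by_cases hK : j ∈ K <;> simp_all

theorem degree_squarefreeExponent {α : Type*} (J : Finset α) :
    (squarefreeExponent J).degree = J.card := by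
  classical
  have hsub : (squarefreeExponent J).support ⊆ J := fun j hj => by
    rw [Finsupp.mem_support_iff, squarefreeExponent_apply] at hj
    by_contra h
    simp [h] at hj
  rw [Finsupp.degree_apply, Finset.sum_subset hsub fun j _ hj => Finsupp.notMem_support_iff.1 hj,
    Finset.card_eq_sum_ones]
  exact Finset.sum_congr rfl fun j hj => by rw [squarefreeExponent_apply, if_pos hj]

/-- A squarefree exponent splits only into squarefree ones with complementary supports; homogeneity
of `p` keeps those with |J| = m. -/
theorem MvPolynomial.IsHomogeneous.coeff_squarefreeExponent_mul {α R : Type*} [DecidableEq α]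
    [CommSemiring R] {p : MvPolynomial α R} {m : ℕ} (hp : p.IsHomogeneous m)
    (q : MvPolynomial α R) (K : Finset α) :
    coeff (squarefreeExponent K) (p * q) = ∑ J ∈ K.powersetCard m,
      coeff (squarefreeExponent J) p * coeff (squarefreeExponent (K \ J)) q := by
  rw [coeff_mul]
  symm
  refine Finset.sum_of_injOn (fun J => (squarefreeExponent J, squarefreeExponent (K \ J)))
    (fun J _ L _ h => squarefreeExponent_injective (Prod.ext_iff.1 h).1) ?_ ?_ fun _ _ => rfl
  · intro J hJ
    have hJ := (Finset.mem_powersetCard.1 hJ).1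
    simp only [Finset.mem_coe, Finset.HasAntidiagonal.mem_antidiagonal]
    ext j
    simp only [Finsupp.add_apply, squarefreeExponent_apply, Finset.mem_sdiff]
    by_cases h : j ∈ J
    · simp [h, hJ h]
    · simp [h]
  · rintro ⟨a, b⟩ hab hnot
    rw [Finset.HasAntidiagonal.mem_antidiagonal] at hab
    have hval : ∀ j, a j + b j = if j ∈ K then 1 else 0 := fun j => by
      rw [← squarefreeExponent_apply, ← hab, Finsupp.add_apply]
    have ha : a = squarefreeExponent a.support := by
      ext j
      rw [squarefreeExponent_apply]
      have := hval j
      by_cases h : a j = 0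
      · simp [h]
      · simp only [Finsupp.mem_support_iff, ne_eq, h, not_false_eq_true, if_true]
        split_ifs at this <;> omega
    have hb : b = squarefreeExponent (K \ a.support) := by
      ext j
      rw [squarefreeExponent_apply]
      have := hval j
      by_cases hK : j ∈ K <;> by_cases h : a j = 0 <;>
        simp only [Finset.mem_sdiff, Finsupp.mem_support_iff, ne_eq, hK, h, if_true, if_false,
          not_true_eq_false, not_false_eq_true, and_true, and_false] at this ⊢ <;>
        omega
    have hsub : a.support ⊆ K := fun j hj => by
      have := hval j
      rw [Finsupp.mem_support_iff] at hj
      by_contra h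
      rw [if_neg h] at this
      omega
    rw [hp.coeff_eq_zero, zero_mul]
    intro hdeg
    refine hnot ⟨a.support, ?_, Prod.ext ha.symm hb.symm⟩
    rw [Finset.mem_coe, Finset.mem_powersetCard]
    rw [ha, degree_squarefreeExponent] at hdeg
    exact ⟨hsub, hdeg⟩

/-- The norm of the coefficient of `∏ j ∈ J, X j`. -/
noncomputable def squarefreeCoeffNorm {α : Type*} (p : MvPolynomial α ℂ) (J : Finset α) : ℝ :=
  ‖coeff (squarefreeExponent J) p‖

/-- By the triangle inequality, the coefficient norms of `p * q` are dominated by the convolution of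
those of `p` and `q`. -/
theorem sliceNormSq_squarefreeCoeffNorm_mul_le {α : Type*} [DecidableEq α] (S : Finset α)
    {p : MvPolynomial α ℂ} {m : ℕ} (hp : p.IsHomogeneous m) (q : MvPolynomial α ℂ) (l : ℕ) :
    sliceNormSq S (m + l) (squarefreeCoeffNorm (p * q)) ≤
      sliceNormSq S m (squarefreeCoeffNorm p) * sliceNormSq S l (squarefreeCoeffNorm q) := by
  refine (sliceNormSq_mono fun K _ => ?_).trans (sliceNormSq_subsetConv_le S m l _ _)
  refine pow_le_pow_left₀ (norm_nonneg _) ?_ 2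
  unfold squarefreeCoeffNorm
  rw [hp.coeff_squarefreeExponent_mul]
  refine (norm_sum_le _ _).trans (le_of_eq ?_)
  exact Finset.sum_congr rfl fun J _ => norm_mul _ _

theorem sliceNormSq_squarefreeCoeffNorm_prod_le {α ι : Type*} (S : Finset α)
    (T : Finset ι) (p : ι → MvPolynomial α ℂ) (m : ι → ℕ)
    (hp : ∀ i ∈ T, (p i).IsHomogeneous (m i)) :
    sliceNormSq S (∑ i ∈ T, m i) (squarefreeCoeffNorm (∏ i ∈ T, p i)) ≤
      ∏ i ∈ T, sliceNormSq S (m i) (squarefreeCoeffNorm (p i)) := by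
  classical
  induction T using Finset.induction_on with
  | empty =>
    have : squarefreeExponent (∅ : Finset α) = 0 := by
      ext j
      simp [squarefreeExponent_apply]
    simp [sliceNormSq_zero, squarefreeCoeffNorm, this]
  | insert i T hi ih =>
    rw [Finset.sum_insert hi, Finset.prod_insert hi, Finset.prod_insert hi]
    refine (sliceNormSq_squarefreeCoeffNorm_mul_le S (hp i (Finset.mem_insert_self i T)) _ _).trans
      (mul_le_mul_of_nonneg_left (ih fun k hk => hp k (Finset.mem_insert_of_mem hk))
        (sliceNormSq_nonneg _ _ _))

/-! ### Permanents as coefficients of products of linear forms -/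

/-- The linear form `∑ j, v j * X j`. -/
noncomputable def linearForm {α R : Type*} [Fintype α] [CommSemiring R] (v : α → R) :
    MvPolynomial α R :=
  ∑ j, C (v j) * X j

theorem isHomogeneous_linearForm {α R : Type*} [Fintype α] [CommSemiring R] (v : α → R) :
    (linearForm v).IsHomogeneous 1 :=
  IsHomogeneous.sum _ _ _ fun _ _ => isHomogeneous_C_mul_X _ _

theorem squarefreeExponent_singleton {α : Type*} (j : α) :
    squarefreeExponent {j} = Finsupp.single j 1 := by
  classical
  ext i
  simp [squarefreeExponent_apply, Finsupp.single_apply, eq_comm]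

theorem coeff_linearForm {α R : Type*} [Fintype α] [CommSemiring R] (v : α → R) (j : α) :
    coeff (Finsupp.single j 1) (linearForm v) = v j := by
  classical
  simp [linearForm, coeff_sum, coeff_C_mul, coeff_X, Finsupp.single_left_inj]

/-- Expanding the product picks an index f(i) in each factor; the monomial obtained is that of J
exactly when f is a bijection onto J, that is, f = e ∘ σ. -/
theorem coeff_prod_linearForm {α ι R : Type*} [Fintype α] [DecidableEq ι] [Fintype ι]
    [CommSemiring R] (A : Matrix α ι R) (J : Finset α) (e : ι ≃ J) :
    coeff (squarefreeExponent J) (∏ i, linearForm fun j => A j i) =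
      Matrix.permanent (Matrix.of fun a b => A (e a) b) := by
  classical
  simp only [linearForm, Finset.prod_univ_sum, Fintype.piFinset_univ, coeff_sum]
  symm
  unfold Matrix.permanent
  have hterm : ∀ f : ι → α, ∏ i, (C (A (f i) i) * X (f i) : MvPolynomial α R) =
      monomial (∑ i, Finsupp.single (f i) 1) (∏ i, A (f i) i) := fun f => by
    rw [monomial_sum_index, map_prod, ← Finset.prod_mul_distrib]
    rfl
  have hcount : ∀ (f : ι → α) (j : α), (∑ i, Finsupp.single (f i) 1 : α →₀ ℕ) j =
      (Finset.univ.filter fun i => f i = j).card := fun f j => by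
    simp [Finsupp.finsetSum_apply, Finsupp.single_apply]
  refine Finset.sum_of_injOn (fun σ i => (e (σ i) : α)) ?_ (fun _ _ => by simp) ?_ ?_
  · intro σ _ τ _ h
    ext i
    exact e.injective (Subtype.ext (congrFun h i))
  · intro f _ hf
    rw [hterm, coeff_monomial, if_neg]
    intro h
    have h1 : ∀ j, (Finset.univ.filter fun i => f i = j).card = if j ∈ J then 1 else 0 :=
      fun j => by rw [← hcount, h, squarefreeExponent_apply]
    have hmem : ∀ i, f i ∈ J := fun i => by
      by_contra hi
      have := h1 (f i)
      rw [if_neg hi, Finset.card_eq_zero] at this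
      exact Finset.notMem_empty i (this ▸ by simp)
    have hsurj : Function.Surjective fun i => e.symm ⟨f i, hmem i⟩ := fun k => by
      have := h1 (e k)
      rw [if_pos (e k).2] at this
      obtain ⟨i, hi⟩ := Finset.card_pos.1 (this ▸ one_pos)
      refine ⟨i, ?_⟩
      rw [Equiv.symm_apply_eq]
      exact Subtype.ext (by simpa using hi)
    refine hf ⟨Equiv.ofBijective _ (Finite.surjective_iff_bijective.1 hsurj), by simp, ?_⟩
    ext i
    simp
  · intro σ _
    rw [hterm, coeff_monomial, if_pos]
    · rfl
    ext j
    rw [hcount, squarefreeExponent_apply]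
    split_ifs with hj
    · rw [Finset.card_eq_one]
      refine ⟨σ.symm (e.symm ⟨j, hj⟩), ?_⟩
      ext i
      simp [Equiv.eq_symm_apply, Subtype.ext_iff]
    · rw [Finset.card_eq_zero, Finset.filter_eq_empty_iff]
      rintro i - rfl
      exact hj (e (σ i)).2

theorem coeff_univ_prod_linearForm {α R : Type*} [Fintype α] [DecidableEq α] [CommSemiring R]
    (A : Matrix α α R) :
    coeff (squarefreeExponent Finset.univ) (∏ i, linearForm fun j => A j i) = A.permanent :=
  coeff_prod_linearForm A Finset.univ (Equiv.subtypeUnivEquiv Finset.mem_univ).symm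

/-! ### The Carlen–Lieb–Loss bound and the block bound -/

theorem sliceWeight_self (n : ℕ) : sliceWeight n n = 1 / (n.factorial : ℝ) ^ 2 := by
  simp [sliceWeight, sq]

theorem sliceWeight_one (n : ℕ) (hn : 1 ≤ n) : sliceWeight n 1 = 1 / n := by
  obtain ⟨k, rfl⟩ := Nat.exists_eq_add_of_le' hn
  rw [← zero_add 1, ← add_assoc, add_zero, sliceWeight_succ_succ, sliceWeight_zero]
  simp

theorem sliceNormSq_univ {α : Type*} [Fintype α] (g : Finset α → ℝ) :
    sliceNormSq Finset.univ (Fintype.card α) g =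
      g Finset.univ ^ 2 / ((Fintype.card α).factorial : ℝ) ^ 2 := by
  rw [sliceNormSq, ← Finset.card_univ, Finset.powersetCard_self, Finset.sum_singleton,
    sliceWeight_self]
  ring

theorem sliceNormSq_linearForm {α : Type*} [Fintype α] [Nonempty α] (v : α → ℂ) :
    sliceNormSq Finset.univ 1 (squarefreeCoeffNorm (linearForm v)) =
      1 / (Fintype.card α : ℝ) * ∑ j, ‖v j‖ ^ 2 := by
  rw [sliceNormSq, Finset.card_univ, sliceWeight_one _ Fintype.card_pos, Finset.powersetCard_one,
    Finset.sum_map]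
  simp [squarefreeCoeffNorm, squarefreeExponent_singleton, coeff_linearForm]

/-- The Carlen–Lieb–Loss inequality of Hadamard type for permanents. -/
theorem Matrix.norm_permanent_sq_le {α : Type*} [Fintype α] [DecidableEq α] (A : Matrix α α ℂ) :
    ‖A.permanent‖ ^ 2 ≤ ((Fintype.card α).factorial : ℝ) ^ 2 *
      ∏ r, (1 / (Fintype.card α : ℝ) * ∑ j, ‖A j r‖ ^ 2) := by
  cases isEmpty_or_nonempty α
  · simp [Matrix.permanent_isEmpty]
  have h := sliceNormSq_squarefreeCoeffNorm_prod_le Finset.univ Finset.univ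
    (fun r => linearForm fun j => A j r) (fun _ => 1) fun _ _ => isHomogeneous_linearForm _
  simp only [Finset.sum_const, Finset.card_univ, smul_eq_mul, mul_one, sliceNormSq_univ,
    sliceNormSq_linearForm, squarefreeCoeffNorm, coeff_univ_prod_linearForm] at h
  rwa [div_le_iff₀' (by positivity)] at h

theorem norm_coeff_prod_linearForm_sq_le {α ι : Type*} [Fintype α] (A : Matrix α ι ℂ)
    (J : Finset α) (T : Finset ι) (h : T.card = J.card) :
    ‖coeff (squarefreeExponent J) (∏ r ∈ T, linearForm fun j => A j r)‖ ^ 2 ≤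
      (T.card.factorial : ℝ) ^ 2 * ∏ j ∈ J, (1 / (T.card : ℝ) * ∑ r ∈ T, ‖A j r‖ ^ 2) := by
  classical
  have e : T ≃ J := Finset.equivOfCardEq h
  rw [← Finset.prod_coe_sort T fun r => linearForm fun j => A j r]
  have h1 := coeff_prod_linearForm (fun j (r : T) => A j r) J e
  -- Transposing makes the product in the bound run over the rows j ∈ J instead of the columns in T.
  rw [h1, ← Matrix.permanent_transpose]
  refine (Matrix.norm_permanent_sq_le _).trans (le_of_eq ?_)
  rw [Fintype.card_coe, ← Finset.prod_coe_sort J, ← e.prod_comp]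
  congr 1
  refine Finset.prod_congr rfl fun t _ => ?_
  rw [← Finset.sum_coe_sort T]
  rfl

theorem sliceWeight_mul_factorial_sq {n m : ℕ} (h : m ≤ n) :
    sliceWeight n m * (m.factorial : ℝ) ^ 2 = 1 / (n.choose m : ℝ) := by
  have h1 := Nat.factorial_ne_zero n
  have h2 := Nat.factorial_ne_zero m
  have h3 := Nat.factorial_ne_zero (n - m)
  rw [sliceWeight, Nat.cast_choose ℝ h]
  field_simp

/-- The factor m!² from the submatrix permanents turns the weight into 1 / C(n, m). -/
theorem sliceNormSq_block_le {n : ℕ} (Z : Matrix (Fin n) (Fin n) ℂ) (T : Finset (Fin n)) :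
    sliceNormSq Finset.univ T.card
        (squarefreeCoeffNorm (∏ r ∈ T, linearForm fun j => Z j r)) ≤
      1 / (n.choose T.card : ℝ) * ∑ I ∈ (Finset.univ : Finset (Fin n)).powersetCard T.card,
        ∏ j ∈ I, blockMean Z T j := by
  have hT : T.card ≤ n := by simpa using T.card_le_univ
  rw [← sliceWeight_mul_factorial_sq hT, mul_assoc, Finset.mul_sum, sliceNormSq, Finset.card_univ,
    Fintype.card_fin]
  refine mul_le_mul_of_nonneg_left (Finset.sum_le_sum fun J hJ => ?_) (sliceWeight_nonneg _ _)
  exact norm_coeff_prod_linearForm_sq_le Z J T (Finset.mem_powersetCard.1 hJ).2.symm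

theorem norm_permanent_sq_le_prod_blocks {n d : ℕ} (M : Fin d → Finset (Fin n))
    (hdisj : ∀ k l, k ≠ l → Disjoint (M k) (M l))
    (hcover : Finset.univ.biUnion M = Finset.univ) (Z : Matrix (Fin n) (Fin n) ℂ) :
    ‖Z.permanent‖ ^ 2 ≤ (n.factorial : ℝ) ^ 2 * ∏ k, (1 / (n.choose (M k).card : ℝ) *
      ∑ I ∈ (Finset.univ : Finset (Fin n)).powersetCard (M k).card,
        ∏ j ∈ I, blockMean Z (M k) j) := by
  have hpair : (↑(Finset.univ : Finset (Fin d)) : Set (Fin d)).PairwiseDisjoint M :=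
    fun k _ l _ hkl => hdisj k l hkl
  have hcard : ∑ k, (M k).card = Fintype.card (Fin n) := by
    rw [← Finset.card_biUnion hpair, hcover, Finset.card_univ]
  have hprod : ∏ k, ∏ r ∈ M k, linearForm (fun j => Z j r) = ∏ r, linearForm fun j => Z j r := by
    rw [← hcover, Finset.prod_biUnion hpair]
  have h := sliceNormSq_squarefreeCoeffNorm_prod_le Finset.univ Finset.univ
    (fun k => ∏ r ∈ M k, linearForm fun j => Z j r) (fun k => (M k).card) fun k _ => by
      simpa using IsHomogeneous.prod (M k) (fun r => linearForm fun j => Z j r) (fun _ => 1)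
        fun r _ => isHomogeneous_linearForm _
  rw [hcard, hprod, sliceNormSq_univ, squarefreeCoeffNorm, coeff_univ_prod_linearForm,
    Fintype.card_fin, div_le_iff₀' (by positivity)] at h
  refine h.trans (mul_le_mul_of_nonneg_left ?_ (by positivity))
  exact Finset.prod_le_prod (fun k _ => sliceNormSq_nonneg _ _ _)
    fun k _ => sliceNormSq_block_le Z (M k)

theorem blockMean_nonneg {n : ℕ} (Z : Matrix (Fin n) (Fin n) ℂ) (S : Finset (Fin n)) (j : Fin n) :
    0 ≤ blockMean Z S j := by
  unfold blockMean; positivity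

theorem mainTheorem1 (n d : ℕ) (hn : 1 ≤ n) (M : Fin d → Finset (Fin n))
    (hne : ∀ k, (M k).Nonempty)
    (hdisj : ∀ k l, k ≠ l → Disjoint (M k) (M l))
    (hcover : Finset.univ.biUnion M = Finset.univ)
    (Z : Matrix (Fin n) (Fin n) ℂ) :
    ‖Z.permanent‖ ≤ blockBound Z M ∧
    ((∀ k, (M k).card = 1) →
      blockBound Z M =
        (n.factorial : ℝ) * ∏ r : Fin n, Real.sqrt ((1 / (n : ℝ)) * ∑ j : Fin n, ‖Z j r‖ ^ 2)) := by
  have hnonneg : ∀ k, 0 ≤ 1 / (n.choose (M k).card : ℝ) *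
      ∑ I ∈ (Finset.univ : Finset (Fin n)).powersetCard (M k).card,
        ∏ j ∈ I, blockMean Z (M k) j := fun k =>
    mul_nonneg (by positivity) (Finset.sum_nonneg fun I _ =>
      Finset.prod_nonneg fun j _ => blockMean_nonneg Z (M k) j)
  refine ⟨?_, fun h1 => ?_⟩
  · have hbound : 0 ≤ blockBound Z M := by unfold blockBound; positivity
    refine (abs_le_of_sq_le_sq' ?_ hbound).2
    refine (norm_permanent_sq_le_prod_blocks M hdisj hcover Z).trans (le_of_eq ?_)
    rw [blockBound, mul_pow, ← Finset.prod_pow]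
    congr 1
    exact Finset.prod_congr rfl fun k _ => (Real.sq_sqrt (hnonneg k)).symm
  · have hpair : (↑(Finset.univ : Finset (Fin d)) : Set (Fin d)).PairwiseDisjoint M :=
      fun k _ l _ hkl => hdisj k l hkl
    rw [blockBound, ← hcover, Finset.prod_biUnion hpair]
    congr 1
    refine Finset.prod_congr rfl fun k _ => ?_
    -- For a block {r}, the mean α_{j,k} is |z_{j,r}|² and the sets I are singletons.
    obtain ⟨r, hr⟩ := Finset.card_eq_one.1 (h1 k)
    simp [hr, blockMean, Finset.powersetCard_one]
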